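/- **Theorem E.** Let $\mathcal R$ be a first-order structure with universe $\mathbb R$ (in a language of any cardinality) that expands $(\mathbb R,<,+,1)$. "Definable" means definable in $\mathcal R$ with parameters, and "$P$-definable" means definable with parameters from $P\subseteq\mathbb R$. Suppose that $\mathcal R$ is *noiseless*, i.e. there are no definable set $X\subseteq\mathbb R$ and non-empty open interval $I$ such that both $X\cap I$ and $I\setminus X$ are dense in $I$. Suppose moreover that at least one of the following holds: - (a) $\mathcal R$ is NIP: there is no formula $\varphi(x;y)$ without parameters ($x,y$ finite tuples of variables) such that for every $N\in\mathbb N$ there are tuples $a_i$ ($i<N$) and $b_S$ ($S\subseteq\{0,\dots,N-1\}$) of real numbers with $\mathcal R\models\varphi(a_i;b_S)\iff i\in S$; - (b) $\mathcal R$ is NTP$_2$: there are no formula $\varphi(x;y)$ without parameters and $k\in\mathbb N$ such that for every $N\in\mathbb N$ there is an array $(b_{i,j})_{i,j<N}$ of tuples of real numbers for which, for each $i$, no $k$ of the formulas $\varphi(x;b_{i,0}),\dots,\varphi(x;b_{i,N-1})$ (with distinct indices) have a common solution in $\mathcal R$, while for every $\eta:\{0,\dots,N-1\}\to\{0,\dots,N-1\}$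 the formulas $\varphi(x;b_{i,\eta(i)})$, $i<N$, have a common solution in $\mathcal R$; - (c) $\mathcal R$ does not define a Cantor set, that is, a non-empty compact subset of $\mathbb R$ that has neither interior nor isolated points. Then: 1. $\mathcal R$ has definable choice: for all $m,n\ge 0$ and every $\emptyset$-definable $A\subseteq\mathbb R^m\times\mathbb R^n$, with $\pi(A)\subseteq\mathbb R^m$ the projection of $A$ to the first $m$ coordinates and $A_a=\{b\in\mathbb R^n:(a,b)\in A\}$, there is an $\emptyset$-definable function $f:\pi(A)\to\mathbb R^n$ such that the graph of $f$ is contained in $A$, and $f(a)=f(b)$ whenever $a,b\in\pi(A)$ and $A_a=A_b$. 2. Anything that $\mathcal R$ interprets is isomorphic to something that it defines. More precisely, let $P\subseteq\mathbb R$ and let $\mathcal M$ be a first-order structure in any language. Suppose that $\mathcal M$ is isomorphic to a structure whose universe is $X/E$ for some $n\ge 0$, some $P$-definable $X\subseteq\mathbb R^n$ and some $P$-definable equivalence relation $E$ on $X$, such that the preimages under $X\to X/E$ of all its basic relations and of the graphs of all its basic functions are $P$-definable. Then $\mathcal M$ is isomorphic to a structure whose universe is a $P$-definable set $Y\subseteq\mathbb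 R^k$ for some $k\ge 0$ and all of whose basic relations and graphs of basic functions are $P$-definable. -/

import Mathlib

open FirstOrder Set Topology

universe u v u' v' w w'

/-! ### Expansions of the real line -/

/-- A first-order structure `L` on `ℝ` is an expansion of `(ℝ, <, +, 1)`: the order, the graph of
addition and the element `1` are definable without parameters. In particular this is so when `L`
has symbols for them. -/
structure IsExpansionOfRealLine (L : FirstOrder.Language.{u, v}) [L.Structure ℝ] : Prop where
  lt_definable : (∅ : Set ℝ).Definable₂ L {p : ℝ × ℝ | p.1 < p.2}
  add_definable : (∅ : Set ℝ).Definable L {x : Fin 3 → ℝ | x 0 + x 1 = x 2}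
  one_definable : (∅ : Set ℝ).Definable₁ L {(1 : ℝ)}

/-- There is a nonempty open interval `I` such that `X ∩ I` is dense and co-dense in `I`. -/
def SomewhereDenseCodense (X : Set ℝ) : Prop :=
  ∃ a b : ℝ, a < b ∧ Ioo a b ⊆ closure (X ∩ Ioo a b) ∧ Ioo a b ⊆ closure (Ioo a b \ X)

/-- No subset of `ℝ` definable (with parameters) is somewhere dense and co-dense. -/
def IsNoiseless (L : FirstOrder.Language.{u, v}) [L.Structure ℝ] : Prop :=
  ∀ X : Set ℝ, (univ : Set ℝ).Definable₁ L X → ¬ SomewhereDenseCodense X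

/-- A nonempty compact subset of `ℝ` without interior and without isolated points. -/
structure IsCantorSet (C : Set ℝ) : Prop where
  nonempty : C.Nonempty
  isCompact : IsCompact C
  interior_eq_empty : interior C = ∅
  no_isolated_point : ∀ x ∈ C, ∀ ε > 0, ∃ y ∈ C, y ≠ x ∧ |y - x| < ε

/-- The structure defines (with parameters) a Cantor set. -/
def DefinesCantorSet (L : FirstOrder.Language.{u, v}) [L.Structure ℝ] : Prop :=
  ∃ C : Set ℝ, IsCantorSet C ∧ (univ : Set ℝ).Definable₁ L C

/-! ### NIP and NTP₂

The properties of the complete theory of `K` are expressed by finite patterns in `K` itself, where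
the number of patterns is unbounded; by compactness these amount to infinite patterns in an
elementary extension. -/

section Tameness

variable (L : FirstOrder.Language.{u, v}) (K : Type w) [L.Structure K]

/-- The partitioned formula `φ(x; y)` has the independence property: it shatters arbitrarily large
finite sets of `x`-tuples. -/
def FormulaHasIP {m n : ℕ} (φ : L.Formula (Fin m ⊕ Fin n)) : Prop :=
  ∀ N : ℕ, ∃ (a : Fin N → Fin m → K) (b : Set (Fin N) → Fin n → K),
    ∀ (i : Fin N) (S : Set (Fin N)), φ.Realize (Sum.elim (a i) (b S)) ↔ i ∈ S

/-- No formula has the independence property. -/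
def IsNIP : Prop :=
  ∀ (m n : ℕ) (φ : L.Formula (Fin m ⊕ Fin n)), ¬ FormulaHasIP L K φ

/-- The partitioned formula `φ(x; y)` has the tree property of the second kind: for some `k` there
are arbitrarily large finite arrays of `y`-tuples such that every row is `k`-inconsistent and every
choice of one entry in each row is consistent. -/
def FormulaHasTP₂ {m n : ℕ} (φ : L.Formula (Fin m ⊕ Fin n)) : Prop :=
  ∃ k : ℕ, ∀ N : ℕ, ∃ b : Fin N → Fin N → Fin n → K,
    (∀ (i : Fin N) (s : Finset (Fin N)), s.card = k →
      ¬ ∃ x : Fin m → K, ∀ j ∈ s, φ.Realize (Sum.elim x (b i j))) ∧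
    ∀ η : Fin N → Fin N, ∃ x : Fin m → K, ∀ i, φ.Realize (Sum.elim x (b i (η i)))

/-- No formula has the tree property of the second kind. -/
def IsNTP₂ : Prop :=
  ∀ (m n : ℕ) (φ : L.Formula (Fin m ⊕ Fin n)), ¬ FormulaHasTP₂ L K φ

end Tameness

/-! ### Definable choice -/

section Choice

variable {K : Type w} {m n : ℕ}

/-- The projection of `A ⊆ K^m × K^n` to the first `m` coordinates. -/
def baseProj (A : Set (Fin m ⊕ Fin n → K)) : Set (Fin m → K) :=
  {a | ∃ b : Fin n → K, Sum.elim a b ∈ A}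

/-- The fiber `A_a ⊆ K^n` of `A ⊆ K^m × K^n` over `a`. -/
def fiberAt (A : Set (Fin m ⊕ Fin n → K)) (a : Fin m → K) : Set (Fin n → K) :=
  {b | Sum.elim a b ∈ A}

/-- The graph, as a subset of `K^m × K^n`, of a function from a subset `D` of `K^m` to `K^n`. -/
def partialGraph {D : Set (Fin m → K)} (f : D → Fin n → K) : Set (Fin m ⊕ Fin n → K) :=
  {z | ∃ a : D, z = Sum.elim a.1 (f a)}

/-- Every `∅`-definable `A ⊆ K^m × K^n` contains the graph of an `∅`-definable function `f` on its
projection such that `f a` depends only on the fiber of `A` over `a`. -/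
def HasDefinableChoice (L : FirstOrder.Language.{u, v}) (K : Type w) [L.Structure K] : Prop :=
  ∀ (m n : ℕ) (A : Set (Fin m ⊕ Fin n → K)), (∅ : Set K).Definable L A →
    ∃ f : baseProj A → Fin n → K,
      (∅ : Set K).Definable L (partialGraph f) ∧ partialGraph f ⊆ A ∧
      ∀ a b : baseProj A, fiberAt A a.1 = fiberAt A b.1 → f a = f b

end Choice

/-! ### Interpretable and definable structures -/

section Interpretation

variable {K : Type w} {n : ℕ}

/-- For a map `p` from a set `X ⊆ K^n` to `N` and a `k`-ary relation `S` on `N`, the set of all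
`(x_1, …, x_k) ∈ X^k ⊆ K^(k × n)` with `(p x_1, …, p x_k) ∈ S`. -/
def pullbackRel {X : Set (Fin n → K)} {N : Type w'} (p : X → N) {k : ℕ} (S : Set (Fin k → N)) :
    Set (Fin k × Fin n → K) :=
  {z | ∃ x : Fin k → X, (∀ i j, z (i, j) = (x i).1 j) ∧ (fun i => p (x i)) ∈ S}

variable (L : FirstOrder.Language.{u, v}) [L.Structure K] (P : Set K)

/-- The `L'`-structure on `N` is `P`-definable in `K` through `p : X → N`: the relations and the
graphs of the functions become `P`-definable when pulled back along `p`. -/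
def IsDefinableThrough {X : Set (Fin n → K)} {N : Type w'} (p : X → N)
    (L' : FirstOrder.Language.{u', v'}) [L'.Structure N] : Prop :=
  (∀ (k : ℕ) (R : L'.Relations k),
    P.Definable L (pullbackRel p {y : Fin k → N | FirstOrder.Language.Structure.RelMap R y})) ∧
  ∀ (k : ℕ) (g : L'.Functions k),
    P.Definable L (pullbackRel p {y : Fin (k + 1) → N |
      FirstOrder.Language.Structure.funMap g (fun i : Fin k => y i.castSucc) = y (Fin.last k)})

variable (L' : FirstOrder.Language.{u', v'}) (M : Type w') [L'.Structure M]

/-- `K` interprets `M` with parameters from `P`: `M` is isomorphic to a structure on the quotient of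
a `P`-definable set `X ⊆ K^n` by a `P`-definable equivalence relation `E`, whose relations and
functions are induced by `P`-definable sets. -/
def Interprets : Prop :=
  ∃ (n : ℕ) (X : Set (Fin n → K)) (E : Setoid X),
    P.Definable L X ∧
    P.Definable L (pullbackRel (id : X → X) {y : Fin 2 → X | E (y 0) (y 1)}) ∧
    ∃ _ : L'.Structure (Quotient E),
      IsDefinableThrough L P (Quotient.mk E) L' ∧ Nonempty (M ≃[L'] Quotient E)

/-- `K` defines, with parameters from `P`, an isomorphic copy of `M`: `M` is isomorphic to a
structure on a `P`-definable set `X ⊆ K^n` whose relations and functions are `P`-definable. -/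
def DefinesCopyOf : Prop :=
  ∃ (n : ℕ) (X : Set (Fin n → K)),
    P.Definable L X ∧
    ∃ _ : L'.Structure X,
      IsDefinableThrough L P (id : X → X) L' ∧ Nonempty (M ≃[L'] X)

end Interpretation

/-! The core is a one-variable dichotomy: every nonempty definable `X ⊆ ℝ` has an interior or an
isolated point, so `goodPoints X r` is nonempty for some `r > 0`. Otherwise noiselessness makes `X`
nowhere dense, its closure is perfect, and cutting the closure at two points outside it leaves a
definable Cantor set (`IsNoiseless.exists_goodPoints_nonempty`).

Given the dichotomy, a point of `X` is singled out canonically. Half the supremum of the good radii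
is again a good radius, its good points form a closed set, and a nonempty closed set has a point
nearest to `0`, ties going to the positive one. This rule needs only `<`, `+` and `1` and depends
only on the set `X`. Applied coordinate by coordinate (`selectedTuples`) it gives definable choice.
Applied to the classes of an equivalence relation it gives a definable transversal, on which an
interpreted structure can be copied.

NIP and NTP₂ enter only to exclude Cantor sets. In a Cantor set `C`, the points with no point of `C`
less than `δ` to their left form a finite set that grows as `δ` shrinks, and new points appear
immediately to the right of each old one. How long the last such point up to `x` survives as `δ`
shrinks can be prescribed independently on successive blocks of thresholds
(`IsCantorSet.exists_newGapBetween`). Rows are blocks, columns are survival times: this is an array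
witnessing TP₂, and two of its columns witness IP. -/

/-! ### Definability of predicates -/

section DefinablePredicates

variable {L : FirstOrder.Language.{u, v}} {K : Type w} [L.Structure K] {P : Set K}
  {α : Type*} {β : Type*} {p q : (α → K) → Prop}

theorem definable_and (hp : P.Definable L {x | p x}) (hq : P.Definable L {x | q x}) :
    P.Definable L {x | p x ∧ q x} :=
  hp.inter hq

theorem definable_or (hp : P.Definable L {x | p x}) (hq : P.Definable L {x | q x}) :
    P.Definable L {x | p x ∨ q x} :=
  hp.union hq

theorem definable_not (hp : P.Definable L {x | p x}) : P.Definable L {x | ¬ p x} :=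
  hp.compl

theorem definable_imp (hp : P.Definable L {x | p x}) (hq : P.Definable L {x | q x}) :
    P.Definable L {x | p x → q x} := by
  convert definable_or (definable_not hp) hq using 3
  exact imp_iff_not_or

theorem definable_comp {p : (α → K) → Prop} (hp : P.Definable L {x | p x}) (f : α → β) :
    P.Definable L {y : β → K | p (y ∘ f)} :=
  hp.preimage_comp f

/-- A family, indexed by `α`-tuples, of subsets of `K` is definable. -/
def DefinableFamily (L : FirstOrder.Language.{u, v}) [L.Structure K] (P : Set K)
    (X : (α → K) → Set K) : Prop :=
  P.Definable L {y : α ⊕ Fin 1 → K | y (Sum.inr 0) ∈ X (y ∘ Sum.inl)}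

theorem DefinableFamily.mem {X : (α → K) → Set K} (hX : DefinableFamily L P X) (f : α → β)
    (j : β) : P.Definable L {y : β → K | y j ∈ X (y ∘ f)} :=
  definable_comp hX (Sum.elim f fun _ => j)

theorem Set.Definable₁.mem {X : Set K} (hX : P.Definable₁ L X) (j : β) :
    P.Definable L {y : β → K | y j ∈ X} :=
  definable_comp hX fun _ => j

theorem definable_exists {p : (α → K) → K → Prop}
    (hp : P.Definable L {y : α ⊕ Fin 1 → K | p (y ∘ Sum.inl) (y (Sum.inr 0))}) :
    P.Definable L {x | ∃ t, p x t} := by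
  convert hp.exists_of_finite using 1
  ext x
  exact ⟨fun ⟨t, ht⟩ => ⟨fun _ => t, ht⟩, fun ⟨t, ht⟩ => ⟨t 0, ht⟩⟩

theorem definable_forall {p : (α → K) → K → Prop}
    (hp : P.Definable L {y : α ⊕ Fin 1 → K | p (y ∘ Sum.inl) (y (Sum.inr 0))}) :
    P.Definable L {x | ∀ t, p x t} := by
  convert hp.forall_of_finite using 1
  ext x
  exact ⟨fun h t => h (t 0), fun h t => h fun _ => t⟩

/-- A definable set is defined by a formula without parameters, once values have been substituted
for finitely many variables. -/
theorem Set.Definable.exists_formula {m n : ℕ} {s : Set (Fin m ⊕ Fin n → K)}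
    (hs : P.Definable L s) :
    ∃ (l : ℕ) (φ : L.Formula (Fin m ⊕ Fin (n + l))) (c : Fin l → K),
      ∀ x y, φ.Realize (Sum.elim x (Fin.append y c)) ↔ Sum.elim x y ∈ s := by
  classical
  obtain ⟨A, -, hA⟩ := definable_iff_finitely_definable.1 hs
  obtain ⟨φ, rfl⟩ := definable_iff_exists_formula_sum.1 hA
  let e : (A : Set K) ≃ Fin A.card := A.equivFin
  refine ⟨A.card, φ.relabel (Sum.elim (fun a => Sum.inr (Fin.natAdd n (e a)))
    (Sum.elim Sum.inl fun j => Sum.inr (Fin.castAdd _ j))), fun i => (e.symm i : K), fun x y => ?_⟩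
  rw [Language.Formula.realize_relabel]
  refine iff_of_eq (congrArg φ.Realize (funext ?_))
  rintro (a | i | j) <;> simp

end DefinablePredicates

/-! ### Definability in expansions of the real line -/

namespace IsExpansionOfRealLine

variable {L : FirstOrder.Language.{u, v}} [L.Structure ℝ] (hL : IsExpansionOfRealLine L)
  {P : Set ℝ} {α : Type*}
include hL

theorem definable_lt (i j : α) : P.Definable L {x : α → ℝ | x i < x j} :=
  (definable_comp hL.lt_definable ![i, j]).mono (empty_subset P)

theorem definable_le (i j : α) : P.Definable L {x : α → ℝ | x i ≤ x j} := by
  simpa only [not_lt] using definable_not (hL.definable_lt (P := P) j i)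

theorem definable_eq (i j : α) : P.Definable L {x : α → ℝ | x i = x j} := by
  simpa only [le_antisymm_iff] using
    definable_and (hL.definable_le (P := P) i j) (hL.definable_le j i)

theorem definable_add (i j k : α) : P.Definable L {x : α → ℝ | x i + x j = x k} :=
  (definable_comp hL.add_definable ![i, j, k]).mono (empty_subset P)

theorem definable_zero (i : α) : P.Definable L {x : α → ℝ | x i = 0} := by
  simpa only [add_eq_left] using hL.definable_add (P := P) i i i

theorem definable_pos (i : α) : P.Definable L {x : α → ℝ | 0 < x i} := by
  convert definable_exists (p := fun (x : α → ℝ) t => t = 0 ∧ t < x i)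
    (definable_and (hL.definable_zero (P := P) _) (hL.definable_lt _ (Sum.inl i))) using 3
  simp

theorem definable_le_one (i : α) : P.Definable L {x : α → ℝ | x i ≤ 1} := by
  convert definable_exists (p := fun (x : α → ℝ) t => t ∈ ({1} : Set ℝ) ∧ x i ≤ t)
    (definable_and ((hL.one_definable.mem _).mono (empty_subset P))
      (hL.definable_le (Sum.inl i) _)) using 3
  simp

theorem definable_lt_add (i j k : α) : P.Definable L {x : α → ℝ | x i < x j + x k} := by
  convert definable_exists (p := fun (x : α → ℝ) t => x j + x k = t ∧ x i < t)
    (definable_and (hL.definable_add (P := P) (Sum.inl j) (Sum.inl k) _)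
      (hL.definable_lt (Sum.inl i) _)) using 3
  simp

theorem definable_add_le (i j k : α) : P.Definable L {x : α → ℝ | x i + x j ≤ x k} := by
  simpa only [not_lt] using definable_not (hL.definable_lt_add (P := P) k i j)

theorem definable_add_nonneg (i j : α) : P.Definable L {x : α → ℝ | 0 ≤ x i + x j} := by
  -- `¬ t + t < t` expresses `0 ≤ t` without a constant for zero.
  convert definable_exists (p := fun (x : α → ℝ) t => x i + x j = t ∧ ¬ t + t < t)
    (definable_and (hL.definable_add (P := P) (Sum.inl i) (Sum.inl j) _)
      (definable_not (by
        convert definable_exists (p := fun (x : α ⊕ Fin 1 → ℝ) t =>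
          x (Sum.inr 0) + x (Sum.inr 0) = t ∧ t < x (Sum.inr 0))
          (definable_and (hL.definable_add (P := P) (Sum.inl (Sum.inr 0)) (Sum.inl (Sum.inr 0)) _)
          (hL.definable_lt _ (Sum.inl (Sum.inr 0)))) using 3
        simp))) using 3
  simp

theorem definable_add_eq_zero (i j : α) : P.Definable L {x : α → ℝ | x i + x j = 0} := by
  convert definable_exists (p := fun (x : α → ℝ) t => x i + x j = t ∧ t = 0)
    (definable_and (hL.definable_add (P := P) (Sum.inl i) (Sum.inl j) _)
      (hL.definable_zero _)) using 3
  simp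

/-- `|a| ≤ |b|` holds iff `b - a` and `b + a` do not have strictly opposite signs. -/
theorem definable_abs_le_abs (i j : α) : P.Definable L {x : α → ℝ | |x i| ≤ |x j|} := by
  convert definable_or
    (definable_and (hL.definable_le (P := P) i j) (hL.definable_add_nonneg i j))
    (definable_and (hL.definable_le (P := P) j i)
      (definable_or (hL.definable_add_eq_zero i j)
        (definable_not (hL.definable_add_nonneg i j)))) using 3 with x
  constructor
  · intro h
    rcases abs_cases (x i) with h1 | h1 <;> rcases abs_cases (x j) with h2 | h2 <;> grind
  · intro h
    rcases abs_cases (x i) with h1 | h1 <;> rcases abs_cases (x j) with h2 | h2 <;> grind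

end IsExpansionOfRealLine

/-! ### Selecting a point of a set of reals -/

/-- The points `x` of `X` such that the ball of radius `r` around `x` is contained in `X` or meets
`X` only in `x`. -/
def goodPoints (X : Set ℝ) (r : ℝ) : Set ℝ :=
  {x | x ∈ X ∧ ((∀ y, x < y + r → y < x + r → y ∈ X) ∨ ∀ y, y ∈ X → x < y + r → y < x + r → y = x)}

/-- The radii at most `1` for which there are good points. -/
def goodRadii (X : Set ℝ) : Set ℝ :=
  {r | 0 < r ∧ r ≤ 1 ∧ ∃ x, x ∈ goodPoints X r}

/-- The points of `F` that are closest to `0`, without those that are negatives of positive points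
of `F`. -/
def nearestPoints (F : Set ℝ) : Set ℝ :=
  {x | x ∈ F ∧ ∀ y, y ∈ F → |x| ≤ |y| ∧ (x + y = 0 → y ≤ x)}

/-- The points of `X` selected by the following rule: take half the supremum of all good radii,
and then the good point for this radius that is nearest to `0`. -/
def selectedPoints (X : Set ℝ) : Set ℝ :=
  {x | ∃ s t, s + s = t ∧ ((∀ r, r ∈ goodRadii X → r ≤ t) ∧
    ∀ b, (∀ r, r ∈ goodRadii X → r ≤ b) → t ≤ b) ∧ x ∈ nearestPoints (goodPoints X s)}

theorem goodPoints_anti (X : Set ℝ) {r s : ℝ} (h : r ≤ s) : goodPoints X s ⊆ goodPoints X r :=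
  fun _ ⟨hx, hx'⟩ => ⟨hx, hx'.imp (fun H y h₁ h₂ => H y (by linarith) (by linarith))
    fun H y hy h₁ h₂ => H y hy (by linarith) (by linarith)⟩

/-- The centers of balls inside `X` avoid all open balls of radius `r` around points of the
complement; the isolated good points are pairwise at distance at least `r`. Both sets are closed,
whatever `X` is. -/
theorem isClosed_goodPoints (X : Set ℝ) {r : ℝ} (hr : 0 < r) : IsClosed (goodPoints X r) := by
  have hunion : goodPoints X r = {x | ∀ y, x < y + r → y < x + r → y ∈ X} ∪
      {x | x ∈ X ∧ ∀ y, y ∈ X → x < y + r → y < x + r → y = x} := by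
    ext x
    constructor
    · rintro ⟨hx, h | h⟩
      · exact Or.inl h
      · exact Or.inr ⟨hx, h⟩
    · rintro (h | ⟨hx, h⟩)
      · exact ⟨h x (by linarith) (by linarith), Or.inl h⟩
      · exact ⟨hx, Or.inr h⟩
  rw [hunion]
  refine IsClosed.union ?_ ?_
  · have : {x | ∀ y, x < y + r → y < x + r → y ∈ X} =
        ⋂ y ∈ Xᶜ, ({x | y + r ≤ x} ∪ {x | x + r ≤ y}) := by
      ext x
      simp only [mem_ofPred_eq, mem_iInter, mem_union, mem_compl_iff]
      refine forall_congr' fun y => ?_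
      rw [← not_lt, ← not_lt]
      tauto
    rw [this]
    exact isClosed_biInter fun y _ => (isClosed_le (by fun_prop) (by fun_prop)).union
      (isClosed_le (by fun_prop) (by fun_prop))
  · refine Metric.isClosed_of_pairwise_le_dist hr fun x hx y hy hxy => ?_
    by_contra! h
    rw [Real.dist_eq, abs_lt] at h
    exact hxy (hx.2 y hy.1 (by linarith) (by linarith)).symm

theorem nearestPoints_nonempty {F : Set ℝ} (hF : IsClosed F) (hne : F.Nonempty) :
    (nearestPoints F).Nonempty := by
  obtain ⟨x, hx, hd⟩ := hF.exists_infDist_eq_dist hne 0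
  have hmin : ∀ y ∈ F, |x| ≤ |y| := fun y hy => by
    simpa [hd, Real.dist_eq] using Metric.infDist_le_dist_of_mem (x := 0) hy
  by_cases hneg : -x ∈ F ∧ x < 0
  · exact ⟨-x, hneg.1, fun y hy => ⟨by simpa using hmin y hy, fun h => by linarith [hneg.2]⟩⟩
  · refine ⟨x, hx, fun y hy => ⟨hmin y hy, fun h => ?_⟩⟩
    obtain rfl : y = -x := by linarith
    by_contra! h'
    exact hneg ⟨hy, by linarith⟩

theorem nearestPoints_subsingleton (F : Set ℝ) : (nearestPoints F).Subsingleton := by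
  rintro x ⟨hx, hx'⟩ y ⟨hy, hy'⟩
  rcases abs_eq_abs.1 (le_antisymm (hx' y hy).1 (hy' x hx).1) with h | h
  · exact h
  · exact le_antisymm ((hy' x hx).2 (by linarith)) ((hx' y hy).2 (by linarith))

theorem selectedPoints_subset (X : Set ℝ) : selectedPoints X ⊆ X := by
  rintro x ⟨s, t, -, -, h⟩
  exact h.1.1

theorem selectedPoints_subsingleton (X : Set ℝ) : (selectedPoints X).Subsingleton := by
  rintro x ⟨s, t, hst, ⟨h₁, h₂⟩, hx⟩ y ⟨s', t', hst', ⟨h₁', h₂'⟩, hy⟩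
  obtain rfl : t = t' := le_antisymm (h₂ _ h₁') (h₂' _ h₁)
  obtain rfl : s = s' := by linarith
  exact nearestPoints_subsingleton _ hx hy

/-- The bound `1` on radii makes the supremum exist. It need not be attained, but half of it lies
below some good radius, and shrinking the radius only adds good points. -/
theorem selectedPoints_nonempty {X : Set ℝ} (hX : ∃ r > 0, (goodPoints X r).Nonempty) :
    (selectedPoints X).Nonempty := by
  obtain ⟨r, hr, hne⟩ := hX
  have hmem : min r 1 ∈ goodRadii X :=
    ⟨by positivity, min_le_right _ _, hne.mono (goodPoints_anti X (min_le_left _ _))⟩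
  have hlub : IsLUB (goodRadii X) (sSup (goodRadii X)) :=
    isLUB_csSup ⟨_, hmem⟩ ⟨1, fun r hr => hr.2.1⟩
  have hpos : 0 < sSup (goodRadii X) := hmem.1.trans_le (hlub.1 hmem)
  obtain ⟨r', hr', hlt⟩ := exists_lt_of_lt_csSup ⟨_, hmem⟩ (half_lt_self hpos)
  obtain ⟨x, hx⟩ := nearestPoints_nonempty (isClosed_goodPoints X (half_pos hpos))
    (Nonempty.mono (goodPoints_anti X hlt.le) hr'.2.2)
  exact ⟨x, _, _, add_halves _, ⟨fun _ h => hlub.1 h, fun b hb => hlub.2 hb⟩, hx⟩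

section DefinableSelection

variable {L : FirstOrder.Language.{u, v}} [L.Structure ℝ] {P : Set ℝ} {α : Type*}
  {X : (α → ℝ) → Set ℝ}

/-- This and the next three lemmas show that the selection rule is uniform in the family and adds no
parameters. -/
theorem DefinableFamily.mem_goodPoints (hL : IsExpansionOfRealLine L)
    (hX : DefinableFamily L P X) {β : Type*} (f : α → β) (j k : β) :
    P.Definable L {y : β → ℝ | y j ∈ goodPoints (X (y ∘ f)) (y k)} :=
  definable_and (hX.mem f j) (definable_or
    (definable_forall (definable_imp (hL.definable_lt_add (Sum.inl j) (Sum.inr 0) (Sum.inl k))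
      (definable_imp (hL.definable_lt_add (Sum.inr 0) (Sum.inl j) (Sum.inl k))
        (hX.mem (Sum.inl ∘ f) (Sum.inr 0)))))
    (definable_forall (definable_imp (hX.mem (Sum.inl ∘ f) (Sum.inr 0))
      (definable_imp (hL.definable_lt_add (Sum.inl j) (Sum.inr 0) (Sum.inl k))
        (definable_imp (hL.definable_lt_add (Sum.inr 0) (Sum.inl j) (Sum.inl k))
          (hL.definable_eq (Sum.inr 0) (Sum.inl j)))))))

theorem DefinableFamily.mem_goodRadii (hL : IsExpansionOfRealLine L)
    (hX : DefinableFamily L P X) {β : Type*} (f : α → β) (k : β) :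
    P.Definable L {y : β → ℝ | y k ∈ goodRadii (X (y ∘ f))} :=
  definable_and (hL.definable_pos k) (definable_and (hL.definable_le_one k)
    (definable_exists (hX.mem_goodPoints hL (Sum.inl ∘ f) (Sum.inr 0) (Sum.inl k))))

theorem DefinableFamily.mem_nearestPoints (hL : IsExpansionOfRealLine L)
    (hX : DefinableFamily L P X) {β : Type*} (f : α → β) (j k : β) :
    P.Definable L {y : β → ℝ | y j ∈ nearestPoints (goodPoints (X (y ∘ f)) (y k))} :=
  definable_and (hX.mem_goodPoints hL f j k) (definable_forall (definable_imp
    (hX.mem_goodPoints hL (Sum.inl ∘ f) (Sum.inr 0) (Sum.inl k))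
    (definable_and (hL.definable_abs_le_abs (Sum.inl j) (Sum.inr 0))
      (definable_imp (hL.definable_add_eq_zero (Sum.inl j) (Sum.inr 0))
        (hL.definable_le (Sum.inr 0) (Sum.inl j))))))

theorem DefinableFamily.selectedPoints (hL : IsExpansionOfRealLine L)
    (hX : DefinableFamily L P X) : DefinableFamily L P fun x => selectedPoints (X x) :=
  definable_exists (definable_exists (definable_and
    (hL.definable_add (Sum.inl (Sum.inr 0)) (Sum.inl (Sum.inr 0)) (Sum.inr 0))
    (definable_and
      (definable_and
        (definable_forall (definable_imp
          (hX.mem_goodRadii hL (Sum.inl ∘ Sum.inl ∘ Sum.inl ∘ Sum.inl) (Sum.inr 0))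
          (hL.definable_le (Sum.inr 0) (Sum.inl (Sum.inr 0)))))
        (definable_forall (definable_imp
          (definable_forall (definable_imp
            (hX.mem_goodRadii hL (Sum.inl ∘ Sum.inl ∘ Sum.inl ∘ Sum.inl ∘ Sum.inl) (Sum.inr 0))
            (hL.definable_le (Sum.inr 0) (Sum.inl (Sum.inr 0)))))
          (hL.definable_le (Sum.inl (Sum.inr 0)) (Sum.inr 0)))))
      (hX.mem_nearestPoints hL (Sum.inl ∘ Sum.inl ∘ Sum.inl) (Sum.inl (Sum.inl (Sum.inr 0)))
        (Sum.inl (Sum.inr 0))))))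

end DefinableSelection

/-! ### Selecting a tuple of a set of tuples -/

/-- The tuples of `X` whose coordinates are selected one after another. -/
def selectedTuples : ∀ n : ℕ, Set (Fin n → ℝ) → Set (Fin n → ℝ)
  | 0, X => X
  | n + 1, X => {x |
      x 0 ∈ selectedPoints {t | ∃ y : Fin n → ℝ, (Fin.cons t y : Fin (n + 1) → ℝ) ∈ X} ∧
      Fin.tail x ∈ selectedTuples n {y | (Fin.cons (x 0) y : Fin (n + 1) → ℝ) ∈ X}}

theorem selectedTuples_subset : ∀ (n : ℕ) (X : Set (Fin n → ℝ)), selectedTuples n X ⊆ X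
  | 0, _ => subset_rfl
  | n + 1, X => fun x hx => by
    simpa using selectedTuples_subset n _ hx.2

theorem selectedTuples_subsingleton : ∀ (n : ℕ) (X : Set (Fin n → ℝ)),
    (selectedTuples n X).Subsingleton
  | 0, _ => fun _ _ _ _ => Subsingleton.elim _ _
  | n + 1, X => fun x hx y hy => by
    have h0 : x 0 = y 0 := selectedPoints_subsingleton _ hx.1 hy.1
    have h1 : Fin.tail x = Fin.tail y :=
      selectedTuples_subsingleton n _ hx.2 (by rw [h0]; exact hy.2)
    rw [← Fin.cons_self_tail x, ← Fin.cons_self_tail y, h0, h1]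

section DefinableTuples

variable {L : FirstOrder.Language.{u, v}} [L.Structure ℝ] {P : Set ℝ}

theorem Set.Definable.fiber_cons {α : Type*} {n : ℕ} {A : Set (α ⊕ Fin (n + 1) → ℝ)}
    (hA : P.Definable L A) :
    P.Definable L {y : (α ⊕ Fin 1) ⊕ Fin n → ℝ | Sum.elim (y ∘ Sum.inl ∘ Sum.inl)
      (Fin.cons (y (Sum.inl (Sum.inr 0))) (y ∘ Sum.inr)) ∈ A} := by
  convert hA.preimage_comp (β := (α ⊕ Fin 1) ⊕ Fin n) (Sum.elim (Sum.inl ∘ Sum.inl)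
    (Fin.cons (Sum.inl (Sum.inr 0)) Sum.inr)) using 1
  ext y
  refine iff_of_eq (congrArg (· ∈ A) (funext ?_))
  rintro (a | j)
  · rfl
  · refine Fin.cases ?_ (fun j => ?_) j <;> simp

/-- The induction is over all index types `α`, because the coordinate just selected joins the base
variables for the remaining ones. -/
theorem Set.Definable.selectedTuples (hL : IsExpansionOfRealLine L) {n : ℕ} :
    ∀ {α : Type*} {A : Set (α ⊕ Fin n → ℝ)}, P.Definable L A →
      P.Definable L {y : α ⊕ Fin n → ℝ |
        y ∘ Sum.inr ∈ selectedTuples n {b | Sum.elim (y ∘ Sum.inl) b ∈ A}} := by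
  induction n with
  | zero =>
    intro α A hA
    convert hA using 1
    ext y
    exact iff_of_eq (congrArg (· ∈ A) (Sum.elim_comp_inl_inr y))
  | succ n ih =>
    intro α A hA
    refine definable_and ?_ ?_
    · have hX : DefinableFamily L P fun x : α → ℝ =>
          {t | ∃ r : Fin n → ℝ, Sum.elim x (Fin.cons t r : Fin (n + 1) → ℝ) ∈ A} :=
        hA.fiber_cons.exists_of_finite
      exact (hX.selectedPoints hL).mem Sum.inl (Sum.inr 0)
    · convert (ih hA.fiber_cons).preimage_comp (β := α ⊕ Fin (n + 1))
        (Sum.elim (Sum.elim Sum.inl fun _ => Sum.inr 0) (Sum.inr ∘ Fin.succ)) using 1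
      rfl

theorem selectedTuples_nonempty
    (hgood : ∀ X : Set ℝ, (univ : Set ℝ).Definable₁ L X → X.Nonempty →
      ∃ r > 0, (goodPoints X r).Nonempty) {n : ℕ} :
    ∀ {X : Set (Fin n → ℝ)}, (univ : Set ℝ).Definable L X → X.Nonempty →
      (selectedTuples n X).Nonempty := by
  induction n with
  | zero => exact fun _ h => h
  | succ n ih =>
    intro X hX ⟨x, hx⟩
    have hcons : (univ : Set ℝ).Definable L
        {y : Fin 1 ⊕ Fin n → ℝ |
          (Fin.cons (y (Sum.inl 0)) (y ∘ Sum.inr) : Fin (n + 1) → ℝ) ∈ X} := by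
      convert hX.preimage_comp (β := Fin 1 ⊕ Fin n) (Fin.cons (Sum.inl 0) Sum.inr) using 1
      ext y
      refine iff_of_eq (congrArg (· ∈ X) (funext fun j => ?_))
      refine Fin.cases ?_ (fun j => ?_) j <;> simp
    obtain ⟨t, ht⟩ := selectedPoints_nonempty (hgood
      {t | ∃ y : Fin n → ℝ, (Fin.cons t y : Fin (n + 1) → ℝ) ∈ X} hcons.exists_of_finite
      ⟨x 0, Fin.tail x, by simpa using hx⟩)
    obtain ⟨b, hb⟩ := selectedPoints_subset _ ht
    -- The fiber over `t` has `t` as a parameter; this is why `hgood` must cover sets definable with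
    -- arbitrary parameters.
    have hfib : (univ : Set ℝ).Definable L
        {y : Fin n → ℝ | (Fin.cons t y : Fin (n + 1) → ℝ) ∈ X} := by
      convert definable_exists (p := fun (y : Fin n → ℝ) s => s ∈ ({t} : Set ℝ) ∧
        (Fin.cons s y : Fin (n + 1) → ℝ) ∈ X)
        (definable_and ((Definable.singleton_of_mem L (mem_univ t)).mem _)
          (definable_comp hcons (Sum.elim (fun _ => Sum.inr 0) Sum.inl))) using 3
      simp
    obtain ⟨y, hy⟩ := ih hfib ⟨b, hb⟩
    exact ⟨Fin.cons t y, by simpa using ht, by simpa using hy⟩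

end DefinableTuples

/-! ### Definable sets in noiseless structures without Cantor sets -/

section Noiseless

variable {L : FirstOrder.Language.{u, v}} [L.Structure ℝ]

theorem Set.Definable₁.closure_inter_Icc (hL : IsExpansionOfRealLine L) {X : Set ℝ}
    (hX : (univ : Set ℝ).Definable₁ L X) (a b : ℝ) :
    (univ : Set ℝ).Definable₁ L (closure X ∩ Icc a b) := by
  have hsing (c : ℝ) := Definable.singleton_of_mem L (mem_univ c)
  have key : closure X ∩ Icc a b = {x | (∀ s, s < x → ∀ t, x < t → ∃ y, y ∈ X ∧ s < y ∧ y < t) ∧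
      (∃ s, s ∈ ({a} : Set ℝ) ∧ s ≤ x) ∧ ∃ s, s ∈ ({b} : Set ℝ) ∧ x ≤ s} := by
    ext x
    simp only [mem_inter_iff, mem_ofPred_eq, mem_singleton_iff, exists_eq_left, mem_Icc]
    refine and_congr_left fun _ => ?_
    rw [mem_closure_iff_nhds_basis (nhds_basis_Ioo x)]
    constructor
    · intro h s hs t ht
      obtain ⟨y, hy, hst⟩ := h (s, t) ⟨hs, ht⟩
      exact ⟨y, hy, hst⟩
    · rintro h ⟨s, t⟩ ⟨hs, ht⟩
      obtain ⟨y, hy, hst⟩ := h s hs t ht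
      exact ⟨y, hy, hst⟩
  rw [key]
  exact definable_and
    (definable_forall (definable_imp (hL.definable_lt (Sum.inr 0) (Sum.inl 0))
      (definable_forall (definable_imp (hL.definable_lt (Sum.inl (Sum.inl 0)) (Sum.inr 0))
        (definable_exists (definable_and (hX.mem (Sum.inr 0))
          (definable_and (hL.definable_lt (Sum.inl (Sum.inl (Sum.inr 0))) (Sum.inr 0))
            (hL.definable_lt (Sum.inr 0) (Sum.inl (Sum.inr 0))))))))))
    (definable_and
      (definable_exists (definable_and ((hsing a).mem (Sum.inr 0))
        (hL.definable_le (Sum.inr 0) (Sum.inl 0))))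
      (definable_exists (definable_and ((hsing b).mem (Sum.inr 0))
        (hL.definable_le (Sum.inl 0) (Sum.inr 0)))))

/-- On an interval inside the closure, `X` would be dense, and also co-dense because it has no
interior. -/
theorem interior_closure_eq_empty_of_not_somewhereDenseCodense {X : Set ℝ}
    (hX : ¬ SomewhereDenseCodense X) (hint : interior X = ∅) : interior (closure X) = ∅ := by
  by_contra hne
  obtain ⟨x, hx⟩ := nonempty_iff_ne_empty.2 hne
  obtain ⟨a, b, hxab, hsub⟩ := mem_nhds_iff_exists_Ioo_subset.1 (mem_interior_iff_mem_nhds.1 hx)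
  refine hX ⟨a, b, hxab.1.trans hxab.2, fun y hy => ?_, fun y hy => ?_⟩
  · rw [inter_comm]
    exact isOpen_Ioo.inter_closure ⟨hy, hsub hy⟩
  · exact isOpen_Ioo.inter_closure ⟨hy, interior_eq_empty_iff_dense_compl.1 hint y⟩

theorem exists_notMem_Ioo_of_interior_eq_empty {C : Set ℝ} (hC : interior C = ∅) {a b : ℝ}
    (hab : a < b) : ∃ x ∈ Ioo a b, x ∉ C := by
  obtain ⟨x, hx, hx'⟩ := (interior_eq_empty_iff_dense_compl.1 hC).exists_mem_open isOpen_Ioo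
    (nonempty_Ioo.2 hab)
  exact ⟨x, hx', hx⟩

theorem IsNoiseless.exists_goodPoints_nonempty (hL : IsExpansionOfRealLine L)
    (hnoiseless : IsNoiseless L) (hC : ¬ DefinesCantorSet L) {X : Set ℝ}
    (hX : (univ : Set ℝ).Definable₁ L X) (hne : X.Nonempty) :
    ∃ r > 0, (goodPoints X r).Nonempty := by
  by_contra! hgood
  have hint : interior X = ∅ := by
    by_contra hne
    obtain ⟨x, hx⟩ := nonempty_iff_ne_empty.2 hne
    obtain ⟨r, hr, hsub⟩ := Metric.mem_nhds_iff.1 (mem_interior_iff_mem_nhds.1 hx)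
    refine (hgood r hr).le ⟨interior_subset hx, Or.inl fun y h₁ h₂ => hsub ?_⟩
    rw [Metric.mem_ball, Real.dist_eq, abs_lt]
    constructor <;> linarith
  have hiso : ∀ x ∈ X, ∀ r > 0, ∃ y ∈ X, y ≠ x ∧ x < y + r ∧ y < x + r := by
    intro x hx r hr
    by_contra! h
    exact (hgood r hr).le ⟨hx, Or.inr fun y hy h₁ h₂ => by
      by_contra hyx
      exact (h y hy hyx h₁).not_gt h₂⟩
  have hcl := interior_closure_eq_empty_of_not_somewhereDenseCodense (hnoiseless X hX) hint
  obtain ⟨x₀, hx₀⟩ := hne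
  -- Cutting at points outside the closure creates no isolated endpoints.
  obtain ⟨a, ha, haX⟩ := exists_notMem_Ioo_of_interior_eq_empty hcl (sub_one_lt x₀)
  obtain ⟨b, hb, hbX⟩ := exists_notMem_Ioo_of_interior_eq_empty hcl (lt_add_one x₀)
  refine hC ⟨closure X ∩ Icc a b, ⟨⟨x₀, subset_closure hx₀, ha.2.le, hb.1.le⟩,
    isCompact_Icc.inter_left isClosed_closure,
    subset_empty_iff.1 ((interior_mono inter_subset_left).trans hcl.subset), ?_⟩,
    hX.closure_inter_Icc hL a b⟩
  rintro x ⟨hx, hax, hxb⟩ ε hε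
  have hax : a < x := lt_of_le_of_ne hax fun h => haX (h ▸ hx)
  have hxb : x < b := lt_of_le_of_ne hxb fun h => hbX (h ▸ hx)
  -- Points within `δ` of `x` stay in `[a, b]`.
  obtain ⟨δ, hδ, hδε, hδa, hδb⟩ : ∃ δ > 0, δ ≤ ε ∧ δ ≤ x - a ∧ δ ≤ b - x :=
    ⟨min ε (min (x - a) (b - x)), by simp [hε, hax, hxb], by simp, by simp, by simp⟩
  obtain ⟨y, hy, hyx, h₁, h₂⟩ : ∃ y ∈ X, y ≠ x ∧ x < y + δ ∧ y < x + δ := by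
    by_cases hxX : x ∈ X
    · exact hiso x hxX δ hδ
    · obtain ⟨y, hy, hd⟩ := Metric.mem_closure_iff.1 hx δ hδ
      rw [Real.dist_eq, abs_lt] at hd
      exact ⟨y, hy, fun h => hxX (h ▸ hy), by linarith, by linarith⟩
  refine ⟨y, ⟨subset_closure hy, by linarith, by linarith⟩, hyx, ?_⟩
  rw [abs_lt]
  constructor <;> linarith

end Noiseless

/-! ### Cantor sets and the tree property of the second kind -/

section CantorSet

/-- The points of `C` whose left neighbor in `C`, if any, has distance at least `δ`. -/
def gapEnds (C : Set ℝ) (δ : ℝ) : Set ℝ :=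
  {x | x ∈ C ∧ ∀ y, y ∈ C → y < x → y + δ ≤ x}

/-- The last point of `gapEnds C δ₀` up to `x` is the last point of `gapEnds C δ₁` up to `x`, but
not that of `gapEnds C δ₂`. -/
def NewGapBetween (C : Set ℝ) (x δ₀ δ₁ δ₂ : ℝ) : Prop :=
  ∃ p, (p ∈ gapEnds C δ₀ ∧ p ≤ x) ∧ (∀ q, q ∈ gapEnds C δ₁ → p < q → x < q) ∧
    ∃ q, q ∈ gapEnds C δ₂ ∧ p < q ∧ q ≤ x

theorem gapEnds_anti (C : Set ℝ) {δ δ' : ℝ} (h : δ' ≤ δ) : gapEnds C δ ⊆ gapEnds C δ' :=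
  fun _ ⟨hx, hx'⟩ => ⟨hx, fun y hy hyx => by linarith [hx' y hy hyx]⟩

/-- Both hypotheses have the same witness `p`, the last point of `gapEnds C δ₀` up to `x`. If `δ₁' ≤
δ₂`, the point that displaces `p` at `δ₂` would already do so at `δ₁'`. This makes the rows of the
array `2`-inconsistent. -/
theorem NewGapBetween.lt {C : Set ℝ} {x δ₀ δ₁ δ₂ δ₁' δ₂' : ℝ} (h : NewGapBetween C x δ₀ δ₁ δ₂)
    (h' : NewGapBetween C x δ₀ δ₁' δ₂') (h₁ : δ₁ ≤ δ₀) (h₁' : δ₁' ≤ δ₀) : δ₂ < δ₁' := by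
  by_contra! hle
  obtain ⟨p, ⟨hp, hpx⟩, hmax, q, hq, hpq, hqx⟩ := h
  obtain ⟨p', ⟨hp', hpx'⟩, hmax', -⟩ := h'
  obtain rfl : p = p' := by
    rcases lt_trichotomy p p' with hlt | heq | hlt
    · exact absurd (hmax p' (gapEnds_anti C h₁ hp') hlt) hpx'.not_gt
    · exact heq
    · exact absurd (hmax' p (gapEnds_anti C h₁' hp) hlt) hpx.not_gt
  exact absurd (hmax' q (gapEnds_anti C hle hq) hpq) hqx.not_gt

variable {C : Set ℝ} (hC : IsCantorSet C)
include hC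

/-- Distinct points are at least `δ` apart and `C` is bounded, so `⌊x / δ⌋` is injective with finite
image. -/
theorem IsCantorSet.finite_gapEnds {δ : ℝ} (hδ : 0 < δ) : (gapEnds C δ).Finite := by
  obtain ⟨a, ha⟩ := hC.isCompact.bddBelow
  obtain ⟨b, hb⟩ := hC.isCompact.bddAbove
  refine Finite.of_finite_image (f := fun x => ⌊x / δ⌋) ((finite_Icc ⌊a / δ⌋ ⌊b / δ⌋).subset ?_) ?_
  · rintro _ ⟨x, hx, rfl⟩
    exact ⟨Int.floor_mono (by gcongr; exact ha hx.1), Int.floor_mono (by gcongr; exact hb hx.1)⟩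
  · have key : ∀ x ∈ gapEnds C δ, ∀ y ∈ gapEnds C δ, ⌊x / δ⌋ = ⌊y / δ⌋ → ¬ x < y := by
      intro x hx y hy h hlt
      have h₁ := Int.abs_sub_lt_one_of_floor_eq_floor h
      have h₂ := hy.2 x hx.1 hlt
      rw [abs_sub_comm, ← sub_div, abs_of_pos (div_pos (by linarith) hδ), div_lt_one hδ] at h₁
      linarith
    intro x hx y hy h
    exact le_antisymm (not_lt.1 (key y hy x hx h.symm)) (not_lt.1 (key x hx y hy h))

/-- Nothing in `C` is less than `δ` to the left of `p`, so `C` accumulates at `p` from the right.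
Pick `x ∈ C` in `(p, p + δ)` and `t ∉ C` in `(p, x)`; the first point `q` of `C` after `t` has a gap
of length at least `q - t` before it, and the next point of `gapEnds C δ` is at least `p + δ > q`.
-/
theorem IsCantorSet.exists_gapEnds {δ : ℝ} (hδ : 0 < δ) {p : ℝ} (hp : p ∈ gapEnds C δ) :
    ∃ δ' > 0, ∃ q ∈ gapEnds C δ', p < q ∧ ∀ e ∈ gapEnds C δ, p < e → q < e := by
  obtain ⟨x, hx, hxp, hdist⟩ := hC.no_isolated_point p hp.1 δ hδ
  rw [abs_lt] at hdist
  have hpx : p < x := by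
    by_contra! h
    linarith [hp.2 x hx (lt_of_le_of_ne h hxp)]
  obtain ⟨t, ht, htC⟩ := exists_notMem_Ioo_of_interior_eq_empty hC.interior_eq_empty hpx
  obtain ⟨q, ⟨hqC, htq, hqx⟩, hmin⟩ := (hC.isCompact.inter_right (isClosed_Icc (a := t) (b := x))
    ).exists_isLeast ⟨x, hx, ht.2.le, le_rfl⟩
  have htq : t < q := lt_of_le_of_ne htq fun h => htC (h ▸ hqC)
  refine ⟨q - t, sub_pos.2 htq, q, ⟨hqC, fun y hy hyq => ?_⟩, ht.1.trans htq, fun e he hpe => ?_⟩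
  · have : y < t := by
      by_contra! h
      exact (hmin ⟨hy, h, hyq.le.trans hqx⟩).not_gt hyq
    linarith
  · linarith [he.2 p hp.1 hpe]

/-- Finiteness of `gapEnds C δ` lets a single threshold serve all its points. -/
theorem IsCantorSet.exists_refinement {δ : ℝ} (hδ : 0 < δ) :
    ∃ δ' > 0, δ' ≤ δ ∧ ∀ p ∈ gapEnds C δ,
      ∃ q ∈ gapEnds C δ', p < q ∧ ∀ e ∈ gapEnds C δ, p < e → q < e := by
  choose! f hf using fun p (hp : p ∈ gapEnds C δ) => hC.exists_gapEnds hδ hp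
  obtain ⟨δ', hδ', hle⟩ : ∃ δ' > 0, ∀ p ∈ gapEnds C δ, δ' ≤ f p := by
    obtain hempty | hne := (gapEnds C δ).eq_empty_or_nonempty
    · exact ⟨1, one_pos, by simp [hempty]⟩
    · obtain ⟨p₀, hp₀, hle⟩ := exists_min_image _ f (hC.finite_gapEnds hδ) hne
      exact ⟨f p₀, (hf p₀ hp₀).1, hle⟩
  refine ⟨min δ' δ, lt_min hδ' hδ, min_le_right _ _, fun p hp => ?_⟩
  obtain ⟨-, q, hq, h⟩ := hf p hp
  exact ⟨q, gapEnds_anti C ((min_le_left _ _).trans (hle p hp)) hq, h⟩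

/-- There is a sequence of positive thresholds such that each point of `gapEnds C (t k)` is the last
one up to some larger point of `gapEnds C (t (k + 1))`. -/
theorem IsCantorSet.exists_thresholds : ∃ t : ℕ → ℝ, Antitone t ∧ ∀ k, ∀ p ∈ gapEnds C (t k),
    ∃ q ∈ gapEnds C (t (k + 1)), p < q ∧ ∀ e ∈ gapEnds C (t k), p < e → q < e := by
  choose f hf using fun δ : {δ : ℝ // 0 < δ} => hC.exists_refinement δ.2
  let t : ℕ → {δ : ℝ // 0 < δ} := fun k => (fun δ => ⟨f δ, (hf δ).1⟩)^[k] ⟨1, one_pos⟩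
  have ht : ∀ k, (t (k + 1) : ℝ) = f (t k) := fun k => by
    simp only [t, Function.iterate_succ_apply']
  refine ⟨fun k => t k, antitone_nat_of_succ_le fun k => ?_, fun k p hp => ?_⟩
  · rw [ht]
    exact (hf (t k)).2.1
  · simp only [ht]
    exact (hf (t k)).2.2 p hp

theorem IsCantorSet.exists_newGapBetween (N : ℕ) : ∃ t : ℕ → ℝ, Antitone t ∧
    ∀ η : ℕ → ℕ, (∀ i, η i < N) →
      ∃ x, ∀ i < N, NewGapBetween C x (t (i * N)) (t (i * N + η i)) (t (i * N + η i + 1)) := by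
  obtain ⟨t, hanti, ht⟩ := hC.exists_thresholds
  refine ⟨t, hanti, fun η hη => ?_⟩
  -- The first `m` rows are realized on the whole interval from `x` to the next point of `gapEnds C
  -- (t (m * N))`, so later rows can be handled by moving right inside it.
  have key : ∀ m, ∃ x ∈ gapEnds C (t (m * N)), ∀ y, x ≤ y →
      (∀ e ∈ gapEnds C (t (m * N)), x < e → y < e) → ∀ i < m,
        NewGapBetween C y (t (i * N)) (t (i * N + η i)) (t (i * N + η i + 1)) := by
    intro m
    induction m with
    | zero =>
      obtain ⟨x, hx, hmin⟩ := hC.isCompact.exists_isLeast hC.nonempty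
      -- The minimum of `C` has no left neighbor, so it is in `gapEnds C δ` for every `δ`.
      exact ⟨x, ⟨hx, fun y hy hyx => absurd hyx (hmin hy).not_gt⟩, by simp⟩
    | succ m ih =>
      -- Keep `p` down to the threshold of index `m * N + η m`, then move to the point `q` that is
      -- new at the next threshold.
      obtain ⟨p, hp, hp'⟩ := ih
      obtain ⟨q, hq, hpq, hmax⟩ := ht (m * N + η m) p (gapEnds_anti C (hanti (by lia)) hp)
      have hle : m * N + η m + 1 ≤ (m + 1) * N := by
        have := hη m
        rw [add_one_mul]
        lia
      refine ⟨q, gapEnds_anti C (hanti hle) hq, fun y hqy hy i hi => ?_⟩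
      have hy' : ∀ e ∈ gapEnds C (t (m * N + η m)), p < e → y < e := fun e he hpe =>
        hy e (gapEnds_anti C (hanti (by lia)) he) (hmax e he hpe)
      rcases Nat.lt_succ_iff_lt_or_eq.1 hi with hi | rfl
      · exact hp' y (hpq.le.trans hqy)
          (fun e he => hy' e (gapEnds_anti C (hanti (by lia)) he)) i hi
      · exact ⟨p, ⟨hp, hpq.le.trans hqy⟩, hy', q, hq, hpq, hqy⟩
  obtain ⟨x, -, hx⟩ := key N
  exact ⟨x, hx x le_rfl fun _ _ h => h⟩

end CantorSet

section TameStructures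

variable {L : FirstOrder.Language.{u, v}} [L.Structure ℝ]

theorem definable_newGapBetween (hL : IsExpansionOfRealLine L) {P C : Set ℝ}
    (hC : P.Definable₁ L C) {α : Type*} (i j₀ j₁ j₂ : α) :
    P.Definable L {x : α → ℝ | NewGapBetween C (x i) (x j₀) (x j₁) (x j₂)} := by
  have hgap {β : Type _} (k j : β) : P.Definable L {y : β → ℝ | y k ∈ gapEnds C (y j)} :=
    definable_and (hC.mem k) (definable_forall (definable_imp (hC.mem (Sum.inr 0))
      (definable_imp (hL.definable_lt (Sum.inr 0) (Sum.inl k))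
        (hL.definable_add_le (Sum.inr 0) (Sum.inl j) (Sum.inl k)))))
  exact definable_exists (definable_and
    (definable_and (hgap (Sum.inr 0) (Sum.inl j₀)) (hL.definable_le (Sum.inr 0) (Sum.inl i)))
    (definable_and
      (definable_forall (definable_imp (hgap (Sum.inr 0) (Sum.inl (Sum.inl j₁)))
        (definable_imp (hL.definable_lt (Sum.inl (Sum.inr 0)) (Sum.inr 0))
          (hL.definable_lt (Sum.inl (Sum.inl i)) (Sum.inr 0)))))
      (definable_exists (definable_and (hgap (Sum.inr 0) (Sum.inl (Sum.inl j₂)))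
        (definable_and (hL.definable_lt (Sum.inl (Sum.inr 0)) (Sum.inr 0))
          (hL.definable_le (Sum.inr 0) (Sum.inl (Sum.inl i))))))))

/-- In an expansion of the real line that defines a Cantor set, some formula has arbitrarily large
arrays with `2`-inconsistent rows and consistent paths. -/
theorem DefinesCantorSet.exists_array (hL : IsExpansionOfRealLine L) (h : DefinesCantorSet L) :
    ∃ (n : ℕ) (φ : L.Formula (Fin 1 ⊕ Fin n)), ∀ N : ℕ, ∃ b : Fin N → Fin N → Fin n → ℝ,
      (∀ i j j', ∀ x : Fin 1 → ℝ, φ.Realize (Sum.elim x (b i j)) →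
        φ.Realize (Sum.elim x (b i j')) → j = j') ∧
      ∀ η : Fin N → Fin N, ∃ x : Fin 1 → ℝ, ∀ i, φ.Realize (Sum.elim x (b i (η i))) := by
  obtain ⟨C, hC, hdef⟩ := h
  -- The formula may not have parameters, so those defining `C` become a constant tail `c` of the
  -- array entries.
  obtain ⟨l, φ, c, hφ⟩ := (definable_newGapBetween hL hdef (α := Fin 1 ⊕ Fin 3)
    (Sum.inl 0) (Sum.inr 0) (Sum.inr 1) (Sum.inr 2)).exists_formula
  refine ⟨3 + l, φ, fun N => ?_⟩
  obtain ⟨t, hanti, ht⟩ := hC.exists_newGapBetween N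
  let b : Fin N → Fin N → Fin 3 → ℝ := fun i j =>
    ![t (i * N), t (i * N + j), t (i * N + j + 1)]
  have hb : ∀ (i j : Fin N) (x : Fin 1 → ℝ), φ.Realize (Sum.elim x (Fin.append (b i j) c)) ↔
      NewGapBetween C (x 0) (t (i * N)) (t (i * N + j)) (t (i * N + j + 1)) :=
    fun i j x => hφ x (b i j)
  refine ⟨fun i j => Fin.append (b i j) c, fun i j j' x h h' => ?_, fun η => ?_⟩
  · rw [hb] at h h'
    have key : ∀ j j' : Fin N,
        NewGapBetween C (x 0) (t (i * N)) (t (i * N + j)) (t (i * N + j + 1)) →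
        NewGapBetween C (x 0) (t (i * N)) (t (i * N + j')) (t (i * N + j' + 1)) → j' ≤ j := by
      intro j j' h h'
      have hlt := h.lt h' (hanti (by lia)) (hanti (by lia))
      by_contra! hjj
      exact hlt.not_ge (hanti (by have : (j : ℕ) < j' := hjj; lia))
    exact le_antisymm (key j' j h' h) (key j j' h h')
  · obtain rfl | hN := N.eq_zero_or_pos
    · exact ⟨0, fun i => i.elim0⟩
    -- The default `0` is an admissible value because `0 < N`.
    · obtain ⟨x, hx⟩ := ht (fun i => if hi : i < N then η ⟨i, hi⟩ else 0) fun i => by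
        split_ifs <;> lia
      refine ⟨fun _ => x, fun i => (hb _ _ _).2 ?_⟩
      simpa using hx i i.2

theorem IsNTP₂.not_definesCantorSet (hL : IsExpansionOfRealLine L) (h : IsNTP₂ L ℝ) :
    ¬ DefinesCantorSet L := by
  intro hC
  obtain ⟨n, φ, hφ⟩ := hC.exists_array hL
  refine h 1 n φ ⟨2, fun N => ?_⟩
  obtain ⟨b, hrow, hpath⟩ := hφ N
  refine ⟨b, fun i s hs ⟨x, hx⟩ => ?_, hpath⟩
  obtain ⟨j, j', hne, rfl⟩ := Finset.card_eq_two.1 hs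
  exact hne (hrow i j j' x (hx j (by simp)) (hx j' (by simp)))

/-- The entries of column `0` are shattered by paths: a path takes column `0` in row `i` if `i ∈ S`,
and otherwise column `1`, which excludes column `0`. -/
theorem IsNIP.not_definesCantorSet (hL : IsExpansionOfRealLine L) (h : IsNIP L ℝ) :
    ¬ DefinesCantorSet L := by
  classical
  intro hC
  obtain ⟨n, φ, hφ⟩ := hC.exists_array hL
  refine h n 1 (φ.relabel Sum.swap) fun N => ?_
  -- Size `N + 2` guarantees two distinct columns even for small `N`.
  obtain ⟨b, hrow, hpath⟩ := hφ (N + 2)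
  choose x hx using fun S : Set (Fin N) => hpath fun i =>
    if ∃ h : (i : ℕ) < N, (⟨i, h⟩ : Fin N) ∈ S then 0 else 1
  refine ⟨fun i => b (Fin.castAdd 2 i) 0, x, fun i S => ?_⟩
  have hi := hx S (Fin.castAdd 2 i)
  have hex : (∃ h : ((Fin.castAdd 2 i : Fin (N + 2)) : ℕ) < N,
      (⟨(Fin.castAdd 2 i : Fin (N + 2)), h⟩ : Fin N) ∈ S) ↔ i ∈ S :=
    ⟨fun ⟨_, h⟩ => h, fun h => ⟨i.2, h⟩⟩
  rw [Language.Formula.realize_relabel, Sum.elim_swap]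
  rw [if_congr hex rfl rfl] at hi
  constructor
  · intro h0
    by_contra hiS
    rw [if_neg hiS] at hi
    exact absurd (hrow _ _ _ _ h0 hi) (by simp)
  · intro hiS
    rwa [if_pos hiS] at hi

end TameStructures

/-! ### Definable choice and elimination of imaginaries -/

section Consequences

theorem Set.Definable.fiber {L : FirstOrder.Language.{u, v}} {K : Type w} [L.Structure K]
    {α β : Type*} [Finite α] {A : Set (α ⊕ β → K)} (hA : (univ : Set K).Definable L A)
    (a : α → K) : (univ : Set K).Definable L {b : β → K | Sum.elim a b ∈ A} := by
  have hconst : (univ : Set K).Definable L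
      {y : β ⊕ α → K | ∀ i, y (Sum.inr i) ∈ ({a i} : Set K)} := by
    simpa only [ofPred_forall] using definable_iInter_of_finite fun i =>
      (Definable.singleton_of_mem L (mem_univ (a i))).mem (β := β ⊕ α) (Sum.inr i)
  convert (definable_and hconst (hA.preimage_comp Sum.swap)).exists_of_finite using 1
  ext b
  have hswap (u : α → K) : Sum.elim b u ∘ Sum.swap = Sum.elim u b := by
    ext (i | i) <;> rfl
  constructor
  · intro h
    exact ⟨a, fun i => rfl, (congrArg (· ∈ A) (hswap a)).mpr h⟩
  · rintro ⟨u, hu, h⟩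
    obtain rfl : u = a := funext hu
    exact (congrArg (· ∈ A) (hswap u)).mp h

theorem Set.Definable.pullbackRel_restrict {L : FirstOrder.Language.{u, v}} {K : Type w}
    [L.Structure K] {P : Set K} {n k : ℕ} {X Y : Set (Fin n → K)} (hYX : Y ⊆ X)
    (hY : P.Definable L Y) {N : Type w'} {p : X → N}
    {S : Set (Fin k → N)} (hS : P.Definable L (pullbackRel p S)) :
    P.Definable L (pullbackRel (fun y : Y => p ⟨y.1, hYX y.2⟩) S) := by
  convert hS.inter (definable_iInter_of_finite fun i : Fin k =>
    hY.preimage_comp (β := Fin k × Fin n) fun j => (i, j)) using 1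
  ext z
  simp only [mem_inter_iff, mem_iInter, mem_preimage]
  constructor
  · rintro ⟨y, hy, hyS⟩
    refine ⟨⟨fun i => ⟨(y i).1, hYX (y i).2⟩, hy, hyS⟩, fun i => ?_⟩
    rw [show z ∘ (fun j => (i, j)) = (y i).1 from funext (hy i)]
    exact (y i).2
  · rintro ⟨⟨x, hx, hxS⟩, hz⟩
    have hxY : ∀ i, (x i).1 ∈ Y := fun i => by
      have := hz i
      rwa [show z ∘ (fun j => (i, j)) = (x i).1 from funext (hx i)] at this
    exact ⟨fun i => ⟨_, hxY i⟩, hx, hxS⟩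

variable {L : FirstOrder.Language.{u, v}} [L.Structure ℝ]

theorem hasDefinableChoice_of_goodPoints (hL : IsExpansionOfRealLine L)
    (hgood : ∀ X : Set ℝ, (univ : Set ℝ).Definable₁ L X → X.Nonempty →
      ∃ r > 0, (goodPoints X r).Nonempty) : HasDefinableChoice L ℝ := by
  intro m n A hA
  -- Real parameters enter only in proving that a fiber has a selected tuple; the formula for the
  -- graph has none.
  choose f hf using fun a : baseProj A =>
    selectedTuples_nonempty hgood ((hA.mono (empty_subset univ)).fiber a.1) a.2
  refine ⟨f, ?_, ?_, fun a b hab => ?_⟩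
  · convert hA.selectedTuples hL using 1
    ext z
    constructor
    · rintro ⟨a, rfl⟩
      exact hf a
    · intro hz
      have hmem : z ∘ Sum.inl ∈ baseProj A := ⟨_, selectedTuples_subset _ _ hz⟩
      refine ⟨⟨_, hmem⟩, ?_⟩
      rw [selectedTuples_subsingleton _ _ (hf ⟨_, hmem⟩) hz, Sum.elim_comp_inl_inr]
  · rintro _ ⟨a, rfl⟩
    exact selectedTuples_subset _ _ (hf a)
  · have hb := hf b
    change _ ∈ selectedTuples n (fiberAt A b.1) at hb
    rw [← hab] at hb
    exact selectedTuples_subsingleton _ _ (hf a) hb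

/-- A `P`-definable equivalence relation has a `P`-definable set of representatives. -/
theorem exists_definable_transversal (hL : IsExpansionOfRealLine L)
    (hgood : ∀ X : Set ℝ, (univ : Set ℝ).Definable₁ L X → X.Nonempty →
      ∃ r > 0, (goodPoints X r).Nonempty) {P : Set ℝ} {n : ℕ} {X : Set (Fin n → ℝ)} (E : Setoid X)
    (hE : P.Definable L (pullbackRel (id : X → X) {y : Fin 2 → X | E (y 0) (y 1)})) :
    ∃ (Y : Set (Fin n → ℝ)) (hYX : Y ⊆ X), P.Definable L Y ∧
      Function.Bijective fun y : Y => Quotient.mk E ⟨y.1, hYX y.2⟩ := by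
  let g : Fin 2 × Fin n → Fin n ⊕ Fin n := fun ij => if ij.1 = 0 then Sum.inl ij.2 else Sum.inr ij.2
  let A : Set (Fin n ⊕ Fin n → ℝ) := (fun y => y ∘ g) ⁻¹'
    pullbackRel (id : X → X) {y : Fin 2 → X | E (y 0) (y 1)}
  have hA : P.Definable L A := hE.preimage_comp g
  have hmemA (x y : Fin n → ℝ) :
      Sum.elim x y ∈ A ↔ ∃ (hx : x ∈ X) (hy : y ∈ X), E ⟨x, hx⟩ ⟨y, hy⟩ := by
    constructor
    · rintro ⟨u, hu, huE⟩
      have h0 : x = u 0 := funext fun j => hu 0 j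
      have h1 : y = u 1 := funext fun j => hu 1 j
      subst h0 h1
      exact ⟨(u 0).2, (u 1).2, huE⟩
    · rintro ⟨hx, hy, hxy⟩
      refine ⟨![⟨x, hx⟩, ⟨y, hy⟩], fun i j => ?_, hxy⟩
      fin_cases i <;> rfl
  let cls : (Fin n → ℝ) → Set (Fin n → ℝ) := fun x => {y | Sum.elim x y ∈ A}
  have hcls {x y : X} (h : E x y) : cls x = cls y := by
    ext z
    change Sum.elim _ _ ∈ A ↔ Sum.elim _ _ ∈ A
    rw [hmemA, hmemA]
    exact ⟨fun ⟨_, hz, hxz⟩ => ⟨y.2, hz, E.trans (E.symm h) hxz⟩,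
      fun ⟨_, hz, hyz⟩ => ⟨x.2, hz, E.trans h hyz⟩⟩
  -- The representatives are the tuples selected from their own class; equivalent tuples have the
  -- same class as a set, hence the same selected tuple.
  have hYX : {y | y ∈ selectedTuples n (cls y)} ⊆ X := fun y hy =>
    ((hmemA y y).1 (selectedTuples_subset _ _ hy)).1
  refine ⟨{y | y ∈ selectedTuples n (cls y)}, hYX,
    (hA.selectedTuples hL).preimage_comp (Sum.elim id id), ?_, ?_⟩
  · rintro ⟨y, hy⟩ ⟨z, hz⟩ hyz
    have h : cls y = cls z := hcls (Quotient.exact hyz)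
    have hz' : z ∈ selectedTuples n (cls z) := hz
    rw [← h] at hz'
    exact Subtype.ext (selectedTuples_subsingleton _ _ hy hz')
  · intro q
    obtain ⟨x, rfl⟩ := Quotient.exists_rep q
    obtain ⟨y, hy⟩ := selectedTuples_nonempty hgood ((hA.mono (subset_univ P)).fiber x.1)
      ⟨x.1, (hmemA _ _).2 ⟨x.2, x.2, E.refl x⟩⟩
    obtain ⟨_, _, hxy⟩ := (hmemA _ _).1 (selectedTuples_subset _ _ hy)
    have hyY : y ∈ selectedTuples n (cls y) := by
      rw [← hcls hxy]
      exact hy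
    exact ⟨⟨y, hyY⟩, Quotient.sound (E.symm hxy)⟩

/-- The structure on `X/E` is transported to a transversal `Y`; its pullbacks to `Y` are the
pullbacks to `X` restricted to tuples from `Y`, hence still `P`-definable. -/
theorem Interprets.definesCopyOf (hL : IsExpansionOfRealLine L)
    (hgood : ∀ X : Set ℝ, (univ : Set ℝ).Definable₁ L X → X.Nonempty →
      ∃ r > 0, (goodPoints X r).Nonempty) {P : Set ℝ} {L' : FirstOrder.Language.{u', v'}}
    {M : Type w} [L'.Structure M] (h : Interprets L P L' M) : DefinesCopyOf L P L' M := by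
  obtain ⟨n, X, E, -, hE, _, ⟨hrel, hfun⟩, ⟨iso⟩⟩ := h
  obtain ⟨Y, hYX, hY, hbij⟩ := exists_definable_transversal hL hgood E hE
  let e : Y ≃ Quotient E := Equiv.ofBijective _ hbij
  let _ : L'.Structure Y := e.symm.inducedStructure
  refine ⟨n, Y, hY, inferInstance, ⟨fun k R => ?_, fun k g => ?_⟩,
    ⟨e.symm.inducedStructureEquiv.comp iso⟩⟩
  · convert Set.Definable.pullbackRel_restrict hYX hY (hrel k R) using 1
    rfl
  · convert Set.Definable.pullbackRel_restrict hYX hY (hfun k g) using 1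
    ext z
    refine exists_congr fun y => and_congr_right fun _ => ?_
    exact e.symm_apply_eq

end Consequences

theorem theoremE (L : FirstOrder.Language.{u, v}) [L.Structure ℝ]
    (hexp : IsExpansionOfRealLine L) (hnoiseless : IsNoiseless L)
    (htame : IsNIP L ℝ ∨ IsNTP₂ L ℝ ∨ ¬ DefinesCantorSet L) :
    HasDefinableChoice L ℝ ∧
    ∀ (P : Set ℝ) (L' : FirstOrder.Language.{u', v'}) (M : Type w) [L'.Structure M],
      Interprets L P L' M → DefinesCopyOf L P L' M := by
  have hC : ¬ DefinesCantorSet L := by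
    rcases htame with h | h | h
    · exact h.not_definesCantorSet hexp
    · exact h.not_definesCantorSet hexp
    · exact h
  have hgood : ∀ X : Set ℝ, (univ : Set ℝ).Definable₁ L X → X.Nonempty →
      ∃ r > 0, (goodPoints X r).Nonempty :=
    fun _ hX hne => hnoiseless.exists_goodPoints_nonempty hexp hC hX hne
  exact ⟨hasDefinableChoice_of_goodPoints hexp hgood,
    fun _ _ _ _ h => h.definesCopyOf hexp hgood⟩
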